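/- Let $\mathcal G$ be a directed graph on the finite vertex set $\mathcal V=\{1,\dots,n\}$ and let $\mathcal C=\{\mathcal C_1,\dots,\mathcal C_K\}$ be a partition of $\mathcal V$ into non-empty clusters. Suppose that 1. every vertex of $\mathcal G$ has a self-link; 2. for any two clusters $\mathcal C_p,\mathcal C_q$, either there are no links from $\mathcal C_q$ to $\mathcal C_p$, or every vertex of $\mathcal C_p$ receives at least one link from $\mathcal C_q$; 3. $\mathcal G$ has cluster-spanning-trees: for each $p$ there is a vertex of $\mathcal V$ (not necessarily in $\mathcal C_p$) from which there are directed paths in $\mathcal G$ to all vertices of $\mathcal C_p$. Let $T\ge 2$. Call a stochastic matrix $A\in\mathbb R^{n\times n}$ a coupling for $\mathcal G$ with reduced matrix $B=[\beta_{pq}]\in\mathbb R^{K\times K}$ if $A_{ij}>0$ exactly when $(j,i)$ is a link of $\mathcal G$, and $\sum_{j\in\mathcal C_q}A_{ij}=\beta_{pq}$ for all $p,q$ and all $i\in\mathcal C_p$. Let $\mathcal T(\mathcal C,\mathcal G)$ be the set of triples $(B,\alpha,(u_1,\dots,u_{T-1}))$ where $B$ is the reduced matrix of some coupling for $\mathcal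 G$, $\alpha\in\mathbb R^K$, and $(u_1,\dots,u_{T-1})\in\mathbb R^{T-1}$. Given a triple, extend $u$ to a $T$-periodic function with zero sum over a period by $u(\theta+kT)=u_\theta$ for $1\le\theta\le T-1$ and $u(kT)=-\sum_{j=1}^{T-1}u_j$, $k\ge 0$, and consider, for a coupling $A$ with reduced matrix $B$, the system $$x_i(t+1)=\sum_{j=1}^n A_{ij}x_j(t)+\alpha_p u(t),\qquad i\in\mathcal C_p,\ p=1,\dots,K,\ t\ge 0 .$$ (a) The system reaches cluster consensus generically: for almost every triple in $\mathcal T(\mathcal C,\mathcal G)$ (with respect to Lebesgue measure, which on the matrices $B$ is that of the affine space of matrices with row sums $1$ and with $\beta_{pq}=0$ whenever $p\neq q$ and there are no links from $\mathcal C_q$ to $\mathcal C_p$), for every coupling $A$ for $\mathcal G$ with reduced matrix $B$, and for almost every $x(0)\in\mathbb R^n$, the solution $x(t)$ is bounded, $\lim_{t\to\infty}|x_i(t)-x_j(t)|=0$ for all $i,j$ in the same cluster, and $\limsup_{t\to\infty}|x_i(t)-x_j(t)|>0$ for all $i,j$ in different clusters. (b) The limiting trajectories are periodic: for every triple in $\mathcal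 T(\mathcal C,\mathcal G)$, every coupling $A$ for $\mathcal G$ with reduced matrix $B$ and every $x(0)\in\mathbb R^n$ there are $T$-periodic scalar trajectories $v_1,\dots,v_K$ with $\lim_{t\to\infty}|x_j(t)-v_p(t)|=0$ for all $j\in\mathcal C_p$, $p=1,\dots,K$. -/

import Mathlib

open Filter Topology MeasureTheory

namespace ClusterConsensus

/-! Vertices are the elements of a finite type `V`, clusters the elements of a finite type `κ`, and a
clustering is the map `c : V → κ` that sends a vertex to its cluster: the cluster `p` is
`{i | c i = p}`. Clusters are non-empty exactly when `c` is surjective. -/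

section Graph

variable {V κ : Type*}

/-- Every vertex has a self-link. -/
def SelfLinked (G : Digraph V) : Prop := ∀ i, G.Adj i i

/-- There is a link of `G` from some vertex of the cluster `q` to some vertex of the cluster `p`. -/
def ClusterLink (G : Digraph V) (c : V → κ) (q p : κ) : Prop :=
  ∃ j i, c j = q ∧ c i = p ∧ G.Adj j i

/-- For any two clusters, either there are no links from the second one to the first one, or each
vertex of the first one receives at least one link from the second one. -/
def NoneOrEveryLink (G : Digraph V) (c : V → κ) : Prop :=
  ∀ p q : κ, ¬ ClusterLink G c q p ∨ ∀ i, c i = p → ∃ j, c j = q ∧ G.Adj j i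

/-- Each cluster `p` has a root, a vertex of `V` (not necessarily in `p`) from which there are
directed paths in `G` to all the vertices of `p`. -/
def HasClusterSpanningTrees (G : Digraph V) (c : V → κ) : Prop :=
  ∀ p : κ, ∃ r : V, ∀ i, c i = p → Relation.ReflTransGen G.Adj r i

/-- The directed graph of a nonnegative matrix: there is a link from `j` to `i` iff `A i j > 0`. -/
def matrixDigraph (A : Matrix V V ℝ) : Digraph V where
  Adj j i := 0 < A i j

/-- The matrix `A` has inter-cluster common influence, with `B` the matrix of the common sums: for
every vertex `i`, the sum of `A i j` over the cluster `q` is `B p q`, where `p` is the cluster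
of `i`. -/
def HasCommonInfluence [Fintype V] [DecidableEq κ] (c : V → κ) (A : Matrix V V ℝ)
    (B : Matrix κ κ ℝ) : Prop :=
  ∀ i q, ∑ j with c j = q, A i j = B (c i) q

/-- `A` is a stochastic matrix with graph exactly `G`, which has inter-cluster common influence with
matrix `B`. -/
def IsCoupling [Fintype V] [DecidableEq V] [DecidableEq κ] (G : Digraph V) (c : V → κ)
    (A : Matrix V V ℝ) (B : Matrix κ κ ℝ) : Prop :=
  A ∈ Matrix.rowStochastic ℝ V ∧ matrixDigraph A = G ∧ HasCommonInfluence c A B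

end Graph

section System

variable {V κ : Type*} [Fintype V]

/-- The `T`-periodic scalar input with `u (θ + k T) = w θ` for `θ = 1, …, T - 1` and
`u (k T) = - (w 1 + ⋯ + w (T - 1))`. -/
def periodicInput (T : ℕ) (w : Finset.Ioo 0 T → ℝ) (t : ℕ) : ℝ :=
  if h : t % T ∈ Finset.Ioo 0 T then w ⟨t % T, h⟩ else - ∑ θ, w θ

/-- The solution of `x_i (t + 1) = ∑_j A_ij x_j (t) + α_p u (t)` for `i` in the cluster `p`, with
initial value `x₀`. -/
def trajectory (A : Matrix V V ℝ) (c : V → κ) (α : κ → ℝ) (u : ℕ → ℝ) (x₀ : V → ℝ) : ℕ → V → ℝ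
  | 0 => x₀
  | t + 1 => fun i => ∑ j, A i j * trajectory A c α u x₀ t j + α (c i) * u t

end System

section Consensus

variable {V κ : Type*}

/-- The trajectory is bounded. -/
def IsBoundedTrajectory (x : ℕ → V → ℝ) : Prop := ∃ M : ℝ, ∀ t i, |x t i| ≤ M

/-- The states of any two vertices of the same cluster approach each other. -/
def IntraClusterSynchronizes (c : V → κ) (x : ℕ → V → ℝ) : Prop :=
  ∀ i j, c i = c j → Tendsto (fun t => |x t i - x t j|) atTop (𝓝 0)

/-- `limsup |x_i (t) - x_j (t)| > 0` (a limit superior in the extended reals) for any `i` and `j` in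
different clusters. -/
def InterClusterSeparates (c : V → κ) (x : ℕ → V → ℝ) : Prop :=
  ∀ i j, c i ≠ c j → 0 < limsup (fun t => ((|x t i - x t j| : ℝ) : EReal)) atTop

/-- The trajectory is bounded, synchronizes inside the clusters and separates the clusters. -/
def IsClusterConsensus (c : V → κ) (x : ℕ → V → ℝ) : Prop :=
  IsBoundedTrajectory x ∧ IntraClusterSynchronizes c x ∧ InterClusterSeparates c x

end Consensus

section Generic

variable {V κ : Type*}

/-- The parameter triples `(B, α, (u_1, …, u_{T-1}))` for the graph `G` and the clustering `c`: the
matrix `B` is that of the inter-cluster common influence of some stochastic matrix with graph `G`,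
and `α` and `u` are arbitrary. -/
def parameterSet [Fintype V] [DecidableEq V] [DecidableEq κ] (G : Digraph V) (c : V → κ) (T : ℕ) :
    Set (Matrix κ κ ℝ × (κ → ℝ) × (Finset.Ioo 0 T → ℝ)) :=
  {τ | ∃ A : Matrix V V ℝ, IsCoupling G c A τ.1}

/-- The positions `(p, q)` of the free entries of `B`: `p ≠ q`, and `G` has a link from the cluster
`q` to the cluster `p`. -/
def FreeEntry (G : Digraph V) (c : V → κ) : Type _ :=
  {pq : κ × κ // pq.1 ≠ pq.2 ∧ ClusterLink G c pq.2 pq.1}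

noncomputable instance [Fintype κ] (G : Digraph V) (c : V → κ) : Fintype (FreeEntry G c) := by
  classical
  exact Subtype.fintype _

open Classical in
/-- The matrix with the prescribed free entries, all other off-diagonal entries equal to `0`, and all
row sums equal to `1`. This is a linear coordinate system on the affine space of the matrices that
have row sums `1` and vanish at `(p, q)` whenever `p ≠ q` and `G` has no links from the cluster `q`
to the cluster `p`. -/
noncomputable def matrixOfFree [Fintype κ] (G : Digraph V) (c : V → κ) (b : FreeEntry G c → ℝ) :
    Matrix κ κ ℝ := fun p q =>
  let off : κ → ℝ := fun q' =>
    if h : p ≠ q' ∧ ClusterLink G c q' p then b ⟨(p, q'), h⟩ else 0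
  if p = q then 1 - ∑ q', off q' else off q

/-- A property `P` of parameter triples holds for almost every triple of `parameterSet G c T`, with
respect to Lebesgue measure: on the matrices `B` this is the Lebesgue measure of the affine space
that is parametrized by `matrixOfFree` (the null sets do not depend on the choice of linear
coordinates in that space), on `α` and `(u_1, …, u_{T-1})` it is the usual one. -/
def ForAlmostEveryParameter [Fintype V] [DecidableEq V] [Fintype κ] [DecidableEq κ]
    (G : Digraph V) (c : V → κ) (T : ℕ)
    (P : Matrix κ κ ℝ → (κ → ℝ) → (Finset.Ioo 0 T → ℝ) → Prop) : Prop :=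
  ∀ᵐ τ : (FreeEntry G c → ℝ) × (κ → ℝ) × (Finset.Ioo 0 T → ℝ),
    (matrixOfFree G c τ.1, τ.2) ∈ parameterSet G c T →
      P (matrixOfFree G c τ.1) τ.2.1 τ.2.2

/-- The coordinates reach every matrix of the parameter set. -/
theorem exists_matrixOfFree_eq [Fintype V] [DecidableEq V] [Fintype κ] [DecidableEq κ]
    {G : Digraph V} {c : V → κ} (hc : Function.Surjective c) {A : Matrix V V ℝ} {B : Matrix κ κ ℝ}
    (h : IsCoupling G c A B) : matrixOfFree G c (fun e => B e.1.1 e.1.2) = B := by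
  classical
  obtain ⟨hA, rfl, hB⟩ := h
  have hpos := hA.1
  have hrow : ∀ i, ∑ j, A i j = 1 := Matrix.sum_row_of_mem_rowStochastic hA
  have hoff : ∀ p q, ¬ ClusterLink (matrixDigraph A) c q p → B p q = 0 := by
    intro p q hpq
    obtain ⟨i, rfl⟩ := hc p
    rw [← hB i q]
    refine Finset.sum_eq_zero fun j hj => ?_
    by_contra hne
    exact hpq ⟨j, i, (Finset.mem_filter.1 hj).2, rfl, lt_of_le_of_ne (hpos i j) (Ne.symm hne)⟩
  have hsum : ∀ p, ∑ q, B p q = 1 := by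
    intro p
    obtain ⟨i, rfl⟩ := hc p
    rw [← hrow i]
    simp_rw [← hB i]
    exact Finset.sum_fiberwise _ _ _
  have key : ∀ p q', (if h : p ≠ q' ∧ ClusterLink (matrixDigraph A) c q' p then B p q' else 0)
      = if q' = p then 0 else B p q' := by
    intro p q'
    by_cases h1 : q' = p
    · simp [h1]
    · by_cases h2 : ClusterLink (matrixDigraph A) c q' p
      · simp [h1, h2, Ne.symm h1]
      · simp [h1, h2, hoff p q' h2]
  ext p q
  simp only [matrixOfFree, key]
  by_cases hpq : p = q
  · subst hpq
    have := hsum p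
    rw [← Finset.add_sum_erase _ _ (Finset.mem_univ p)] at this
    rw [if_pos rfl, ← Finset.add_sum_erase _ _ (Finset.mem_univ p), if_pos rfl, zero_add,
      Finset.sum_congr rfl (fun x hx => if_neg (Finset.ne_of_mem_erase hx))]
    linarith
  · rw [if_neg hpq, if_neg (Ne.symm hpq)]

end Generic

end ClusterConsensus

/-! A positive diagonal rules out oscillation: the powers `A ^ t` of the stochastic matrix converge
pointwise (`exists_tendsto_pow_mulVec`). Since the input has zero sum over a period, its response
over one period lies in the range of `1 - A`, so a periodic trajectory exists, and every trajectory
approaches one (`exists_periodic_trajectory_tendsto`). Along a periodic trajectory each state `v`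
satisfies `v = A ^ (N * T) *ᵥ v + g ∘ c` for every `N`. For large `N` two vertices of a cluster both
put positive weight on the root of that cluster, and a maximum principle (`eq_of_common_influence`)
makes `v` constant on clusters. What remains is a periodic solution of the reduced system with
matrix `B`, which gives boundedness, synchronization and (b).

For separation, let `ζ ≠ 1` be a `T`-th root of unity. The Fourier coefficients `V` of the reduced
solution and `U` of the input satisfy `(1 - ζ B) V = ζ U α`, and `1 - ζ B` is invertible by diagonal
dominance. Coinciding components of `V` impose a nontrivial linear condition on `α`, and `U = 0` one
on `u`; both fail almost everywhere. The exceptional set involves neither `A` nor `x(0)`, so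
separation holds for every initial value. -/

namespace ClusterConsensus

open Matrix

/-! ### Convergence of powers of stochastic matrices with positive diagonal -/

section StochasticPowers

variable {V : Type*} [Fintype V] [DecidableEq V] {A : Matrix V V ℝ}

theorem mulVec_const_of_mem_rowStochastic (hA : A ∈ rowStochastic ℝ V) (m : ℝ) :
    A *ᵥ (fun _ => m) = fun _ => m := by
  ext i
  simp [mulVec, dotProduct, ← Finset.sum_mul, sum_row_of_mem_rowStochastic hA]

theorem mulVec_nonneg_of_mem_rowStochastic (hA : A ∈ rowStochastic ℝ V) {z : V → ℝ}
    (hz : ∀ i, 0 ≤ z i) (i : V) : 0 ≤ (A *ᵥ z) i :=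
  Finset.sum_nonneg fun j _ => mul_nonneg (hA.1 i j) (hz j)

theorem mulVec_le_of_mem_rowStochastic (hA : A ∈ rowStochastic ℝ V) {z : V → ℝ} {m : ℝ}
    (hz : ∀ i, z i ≤ m) (i : V) : (A *ᵥ z) i ≤ m := by
  have h := mulVec_nonneg_of_mem_rowStochastic hA (z := (fun _ => m) - z)
    (fun i => sub_nonneg.2 (hz i)) i
  rw [mulVec_sub, mulVec_const_of_mem_rowStochastic hA] at h
  simpa using h

theorem abs_mulVec_le_of_mem_rowStochastic (hA : A ∈ rowStochastic ℝ V) {z : V → ℝ} {m : ℝ}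
    (hz : ∀ i, |z i| ≤ m) (i : V) : |(A *ᵥ z) i| ≤ m := by
  refine abs_le'.2 ⟨mulVec_le_of_mem_rowStochastic hA (fun i => (abs_le'.1 (hz i)).1) i, ?_⟩
  have := mulVec_le_of_mem_rowStochastic hA (z := -z) (fun i => (abs_le'.1 (hz i)).2) i
  simpa [mulVec_neg] using this

/-- The slack below an upper bound decreases at most geometrically along the powers of a stochastic
matrix with positive diagonal. -/
theorem pow_mul_le_pow_mulVec (hA : A ∈ rowStochastic ℝ V) {δ : ℝ} (hδ : 0 ≤ δ)
    (hd : ∀ i, δ ≤ A i i) {h : V → ℝ} (hh : ∀ i, 0 ≤ h i) (k : ℕ) (i : V) :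
    δ ^ k * h i ≤ ((A ^ k) *ᵥ h) i := by
  induction k with
  | zero => simp
  | succ k ih =>
    have hk := mulVec_nonneg_of_mem_rowStochastic (pow_mem hA k) hh
    rw [pow_succ' A, ← mulVec_mulVec]
    calc δ ^ (k + 1) * h i = δ * (δ ^ k * h i) := by ring
      _ ≤ δ * ((A ^ k) *ᵥ h) i := by gcongr
      _ ≤ A i i * ((A ^ k) *ᵥ h) i := mul_le_mul_of_nonneg_right (hd i) (hk i)
      _ ≤ _ := Finset.single_le_sum (f := fun j => A i j * ((A ^ k) *ᵥ h) j)
        (fun j _ => mul_nonneg (hA.1 i j) (hk j)) (Finset.mem_univ i)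

/-- The maxima `M t` of `d t = A ^ t (z - A z)` decrease to some `m`. If `M` barely drops over `S`
steps, a maximizing vertex at the end was near the maximum throughout, because its slack shrinks at
most by the factor `δ` per step. The sum of `d` there is then about `S * m`, yet it telescopes to at
most `2 * C`; hence `m ≤ 0`. -/
theorem exists_tendsto_upperBound (hA : A ∈ rowStochastic ℝ V) (hpos : ∀ i, 0 < A i i)
    (z : V → ℝ) : ∃ (M : ℕ → ℝ) (m : ℝ), m ≤ 0 ∧ Tendsto M atTop (𝓝 m) ∧
      ∀ t i, ((A ^ t) *ᵥ (z - A *ᵥ z)) i ≤ M t := by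
  cases isEmpty_or_nonempty V
  · exact ⟨fun _ => 0, 0, le_rfl, tendsto_const_nhds, fun t i => isEmptyElim i⟩
  set d : ℕ → V → ℝ := fun t => (A ^ t) *ᵥ (z - A *ᵥ z) with hdd
  have hadd : ∀ s k, d (s + k) = (A ^ k) *ᵥ d s := fun s k => by
    simp only [hdd, mulVec_mulVec, ← pow_add, add_comm k s]
  set M : ℕ → ℝ := fun t => ⨆ i, d t i
  have hle : ∀ t i, d t i ≤ M t := fun t i => le_ciSup (Set.finite_range (d t)).bddAbove i
  obtain ⟨δ, hδ, hd⟩ : ∃ δ : ℝ, 0 < δ ∧ ∀ i, δ ≤ A i i := by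
    obtain ⟨i, hi⟩ := Finite.exists_min fun i => A i i
    exact ⟨A i i, hpos i, hi⟩
  obtain ⟨C, hC⟩ : ∃ C, ∀ i, |z i| ≤ C := by
    obtain ⟨i, hi⟩ := Finite.exists_max fun i => |z i|
    exact ⟨_, hi⟩
  have hpC : ∀ t i, |((A ^ t) *ᵥ z) i| ≤ C := fun t =>
    abs_mulVec_le_of_mem_rowStochastic (pow_mem hA t) hC
  have hdt : ∀ t, d t = (A ^ t) *ᵥ z - (A ^ (t + 1)) *ᵥ z := fun t => by
    simp [hdd, mulVec_sub, pow_succ]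
  have hanti : Antitone M := antitone_nat_of_succ_le fun t => ciSup_le fun i => by
    rw [hadd t 1, pow_one]
    exact mulVec_le_of_mem_rowStochastic hA (hle t) i
  have hbdd : BddBelow (Set.range M) := by
    refine ⟨-(2 * C), ?_⟩
    rintro _ ⟨t, rfl⟩
    obtain ⟨i⟩ := ‹Nonempty V›
    refine le_trans ?_ (hle t i)
    rw [hdt, Pi.sub_apply]
    linarith [abs_le.1 (hpC t i), abs_le.1 (hpC (t + 1) i), (abs_le.1 (hpC t i)).1,
      (abs_le.1 (hpC (t + 1) i)).2]
  have hlim := tendsto_atTop_ciInf hanti hbdd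
  set m := ⨅ t, M t
  refine ⟨M, m, ?_, hlim, hle⟩
  have key : ∀ S s : ℕ, S * M s - S * (M s - M (s + S)) / δ ^ S ≤ 2 * C := by
    intro S s
    -- The vertex is chosen at the last time `s + S`, and its slack is controlled backwards.
    obtain ⟨i, hi⟩ := exists_eq_ciSup_of_finite (f := d (s + S))
    have hsum : ∑ k ∈ Finset.range S, d (s + k) i ≤ 2 * C := by
      have : ∀ k, d (s + k) i = ((A ^ (s + k)) *ᵥ z) i - ((A ^ (s + (k + 1))) *ᵥ z) i := fun k => by
        rw [hdt]; rfl
      rw [Finset.sum_congr rfl fun k _ => this k,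
        Finset.sum_range_sub' fun k => ((A ^ (s + k)) *ᵥ z) i]
      linarith [(abs_le.1 (hpC (s + 0) i)).2, (abs_le.1 (hpC (s + S) i)).1]
    refine le_trans ?_ hsum
    have hterm : ∀ k ∈ Finset.range S, M s - (M s - M (s + S)) / δ ^ S ≤ d (s + k) i := by
      intro k hk
      have hkS := (Finset.mem_range.1 hk).le
      have hnn : ∀ j, 0 ≤ ((fun _ => M s) - d (s + k) : V → ℝ) j := fun j =>
        sub_nonneg.2 ((hle _ _).trans (hanti (Nat.le_add_right s k)))
      have h1 := pow_mul_le_pow_mulVec hA hδ.le hd hnn (S - k) i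
      rw [mulVec_sub, mulVec_const_of_mem_rowStochastic (pow_mem hA _), ← hadd,
        add_assoc, Nat.add_sub_cancel' hkS] at h1
      have hδ1 : δ ≤ 1 := (hd i).trans (le_one_of_mem_rowStochastic hA)
      have h2 : δ ^ S * (M s - d (s + k) i) ≤ M s - M (s + S) := by
        refine le_trans (mul_le_mul_of_nonneg_right
          (pow_le_pow_of_le_one hδ.le hδ1 (Nat.sub_le S k)) (hnn i)) (h1.trans_eq ?_)
        simp only [Pi.sub_apply, hi, M]
      have h3 : M s - d (s + k) i ≤ (M s - M (s + S)) / δ ^ S := by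
        rw [le_div_iff₀ (by positivity)]
        linarith
      linarith
    calc _ = ∑ k ∈ Finset.range S, (M s - (M s - M (s + S)) / δ ^ S) := by
          simp; ring
      _ ≤ _ := Finset.sum_le_sum hterm
  have hS : ∀ S : ℕ, S * m ≤ 2 * C := by
    intro S
    have hl : Tendsto (fun s => S * M s - S * (M s - M (s + S)) / δ ^ S) atTop
        (𝓝 (S * m - S * (m - m) / δ ^ S)) :=
      (hlim.const_mul _).sub (((hlim.sub (hlim.comp (tendsto_add_atTop_nat S))).const_mul _).div_const _)
    have := le_of_tendsto hl (Eventually.of_forall (key S))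
    simpa using this
  by_contra! hm
  obtain ⟨S, hS'⟩ := exists_nat_gt (2 * C / m)
  rw [div_lt_iff₀ hm] at hS'
  exact absurd (hS S) hS'.not_ge

/-- The powers of a stochastic matrix with positive diagonal are asymptotically regular. -/
theorem tendsto_pow_mulVec_sub (hA : A ∈ rowStochastic ℝ V) (hpos : ∀ i, 0 < A i i) (z : V → ℝ) :
    Tendsto (fun t => (A ^ t) *ᵥ (z - A *ᵥ z)) atTop (𝓝 0) := by
  rw [tendsto_pi_nhds]
  intro i
  obtain ⟨M, m, hm, hM, hle⟩ := exists_tendsto_upperBound hA hpos z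
  obtain ⟨N, n, hn, hN, hge⟩ := exists_tendsto_upperBound hA hpos (-z)
  have hge' : ∀ t, -N t ≤ ((A ^ t) *ᵥ (z - A *ᵥ z)) i := fun t => by
    have := hge t i
    rw [mulVec_neg, neg_sub_neg, ← neg_sub, mulVec_neg, Pi.neg_apply] at this
    linarith
  have hnm : -n ≤ m := le_of_tendsto_of_tendsto' hN.neg hM fun t => (hge' t).trans (hle t i)
  obtain rfl : m = 0 := by linarith
  obtain rfl : n = 0 := by linarith
  exact tendsto_of_tendsto_of_tendsto_of_le_of_le (by simpa using hN.neg) hM hge' fun t => hle t i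

/-- The powers of a stochastic matrix with positive diagonal converge, and the limits are fixed. -/
theorem exists_tendsto_pow_mulVec (hA : A ∈ rowStochastic ℝ V) (hpos : ∀ i, 0 < A i i)
    (z : V → ℝ) : ∃ y, A *ᵥ y = y ∧ Tendsto (fun t => (A ^ t) *ᵥ z) atTop (𝓝 y) := by
  set f : (V → ℝ) →ₗ[ℝ] V → ℝ := LinearMap.id - A.mulVecLin with hf
  have hfz : ∀ z, f z = z - A *ᵥ z := fun z => by simp [hf]
  have hfix : ∀ y, A *ᵥ y = y → ∀ t : ℕ, (A ^ t) *ᵥ y = y := by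
    intro y hy t
    induction t with
    | zero => simp
    | succ t ih => rw [pow_succ, ← mulVec_mulVec, hy, ih]
  -- On the range of `1 - A` the powers tend to `0`, on its kernel they are constant; so the two
  -- subspaces meet in `0` and, by dimension, span the space.
  have hdisj : Disjoint f.range f.ker := by
    rw [Submodule.disjoint_def]
    rintro _ ⟨x, rfl⟩ hx
    rw [LinearMap.mem_ker, hfz, sub_eq_zero] at hx
    have h1 := tendsto_pow_mulVec_sub hA hpos x
    rw [← hfz] at h1
    simp only [hfix _ hx.symm] at h1
    exact tendsto_nhds_unique tendsto_const_nhds h1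
  have htop := Submodule.eq_top_of_disjoint _ _
    (LinearMap.finrank_range_add_finrank_ker f).ge hdisj
  obtain ⟨_, ⟨x, rfl⟩, y, hy, rfl⟩ := Submodule.mem_sup.1 (htop ▸ Submodule.mem_top : z ∈ _)
  rw [LinearMap.mem_ker, hfz, sub_eq_zero] at hy
  refine ⟨y, hy.symm, ?_⟩
  simp only [mulVec_add, hfix y hy.symm, hfz]
  simpa using (tendsto_pow_mulVec_sub hA hpos x).add_const y

end StochasticPowers

/-! ### The periodic input of zero mean -/

section PeriodicInput

theorem sum_periodicInput {T : ℕ} (hT : 0 < T) (w : Finset.Ioo 0 T → ℝ) :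
    ∑ s ∈ Finset.range T, periodicInput T w s = 0 := by
  have hr : Finset.range T = insert 0 (Finset.Ioo 0 T) := by
    ext s; simp only [Finset.mem_range, Finset.mem_insert, Finset.mem_Ioo]; omega
  rw [hr, Finset.sum_insert (by simp), ← Finset.sum_coe_sort]
  have h : ∀ s : Finset.Ioo 0 T, periodicInput T w s = w s := fun s => by
    have hs : (s : ℕ) % T = s := Nat.mod_eq_of_lt (Finset.mem_Ioo.1 s.2).2
    simp only [periodicInput, hs, s.2, dif_pos]
  rw [Finset.sum_congr rfl fun s _ => h s]
  simp [periodicInput]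

theorem periodicInput_periodic (T : ℕ) (w : Finset.Ioo 0 T → ℝ) :
    Function.Periodic (periodicInput T w) T := fun t => by
  simp [periodicInput]

end PeriodicInput

/-! ### Existence and attraction of periodic trajectories -/

section Trajectories

variable {V κ : Type*} [Fintype V] {A : Matrix V V ℝ} {c : V → κ} {α : κ → ℝ} {u : ℕ → ℝ}

theorem trajectory_succ (x : V → ℝ) (t : ℕ) :
    trajectory A c α u x (t + 1) = A *ᵥ trajectory A c α u x t + u t • (α ∘ c) := by
  ext i
  simp [trajectory, mulVec, dotProduct, mul_comm]

theorem trajectory_add (x : V → ℝ) (s t : ℕ) :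
    trajectory A c α u x (t + s) =
      trajectory A c α (fun r => u (r + s)) (trajectory A c α u x s) t := by
  induction t with
  | zero => simp [trajectory]
  | succ t ih => rw [add_right_comm, trajectory_succ, trajectory_succ, ih]

theorem trajectory_periodic {T : ℕ} (hu : Function.Periodic u T) {x : V → ℝ}
    (hx : trajectory A c α u x T = x) : Function.Periodic (trajectory A c α u x) T := fun t => by
  have : (fun r => u (r + T)) = u := funext hu
  rw [trajectory_add, hx, this]

/-- Modulo the range of `1 - A` the matrix acts as the identity, so the inputs simply add up. -/
theorem trajectory_zero_sub_mem_range (t : ℕ) :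
    ∃ e : V → ℝ, trajectory A c α u 0 t - (∑ s ∈ Finset.range t, u s) • (α ∘ c) = e - A *ᵥ e := by
  induction t with
  | zero => exact ⟨0, by simp [trajectory]⟩
  | succ t ih =>
    obtain ⟨e, he⟩ := ih
    refine ⟨e - trajectory A c α u 0 t, ?_⟩
    rw [trajectory_succ, Finset.sum_range_succ, add_smul, mulVec_sub]
    linear_combination (exp := 1) he

variable [DecidableEq V]

theorem trajectory_sub_trajectory (x y : V → ℝ) (t : ℕ) :
    trajectory A c α u x t - trajectory A c α u y t = (A ^ t) *ᵥ (x - y) := by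
  induction t with
  | zero => simp [trajectory]
  | succ t ih =>
    rw [trajectory_succ, trajectory_succ, add_sub_add_right_eq_sub, ← mulVec_sub, ih, mulVec_mulVec,
      pow_succ']

/-- A stochastic system with positive self-influences and a periodic input of zero mean has a
periodic trajectory. -/
theorem exists_trajectory_eq_self (hA : A ∈ rowStochastic ℝ V) (hpos : ∀ i, 0 < A i i)
    {T : ℕ} (hT : T ≠ 0) (hsum : ∑ s ∈ Finset.range T, u s = 0) :
    ∃ d : V → ℝ, trajectory A c α u d T = d := by
  obtain ⟨e, he⟩ := trajectory_zero_sub_mem_range (A := A) (c := c) (α := α) (u := u) T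
  rw [hsum, zero_smul, sub_zero] at he
  -- Periodicity asks for `(1 - A ^ T) d = (1 - A) e`. Cancelling `1 - A`, it suffices to solve `S d
  -- = e`.
  set S : Matrix V V ℝ := ∑ k ∈ Finset.range T, A ^ k
  have hS : (1 - A) * S = 1 - A ^ T := mul_neg_geom_sum A T
  have hinj : Function.Injective S.mulVecLin := by
    rw [← LinearMap.ker_eq_bot, LinearMap.ker_eq_bot']
    intro d hd
    rw [mulVecLin_apply] at hd
    have h1 : (A ^ T) *ᵥ d = d := by
      have : (1 - A ^ T) *ᵥ d = 0 := by rw [← hS, ← mulVec_mulVec, hd, mulVec_zero]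
      rw [sub_mulVec, one_mulVec, sub_eq_zero] at this
      exact this.symm
    have h2 : ∀ k : ℕ, (A ^ (T * k)) *ᵥ d = d := by
      intro k
      induction k with
      | zero => simp
      | succ k ih => rw [mul_add, mul_one, pow_add, ← mulVec_mulVec, h1, ih]
    -- As `A ^ (T * k)` fixes `d`, the limit of the powers on `d` is `d` itself. So `A` fixes `d`,
    -- and `S d = T d` forces `d = 0`.
    obtain ⟨y, hy, hlim⟩ := exists_tendsto_pow_mulVec hA hpos d
    have h3 := hlim.comp (tendsto_id.const_mul_atTop' (Nat.pos_of_ne_zero hT))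
    simp only [Function.comp_def, id, h2] at h3
    obtain rfl := tendsto_nhds_unique h3 tendsto_const_nhds
    have h4 : ∀ k : ℕ, (A ^ k) *ᵥ y = y := by
      intro k
      induction k with
      | zero => simp
      | succ k ih => rw [pow_succ, ← mulVec_mulVec, hy, ih]
    rw [sum_mulVec, Finset.sum_congr rfl fun k _ => h4 k] at hd
    rw [Finset.sum_const, Finset.card_range] at hd
    exact (smul_eq_zero.1 hd).resolve_left hT
  obtain ⟨d, hd⟩ := LinearMap.surjective_of_injective hinj e
  rw [mulVecLin_apply] at hd
  refine ⟨d, ?_⟩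
  have h5 := trajectory_sub_trajectory (A := A) (c := c) (α := α) (u := u) d 0 T
  have h6 : d - (A ^ T) *ᵥ d = trajectory A c α u 0 T := by
    have h7 : (1 - A ^ T) *ᵥ d = (1 - A) *ᵥ e := by rw [← hS, ← mulVec_mulVec, hd]
    simpa only [sub_mulVec, one_mulVec, he] using h7
  rw [sub_zero, sub_eq_iff_eq_add, ← h6] at h5
  rw [h5]; abel

/-- Every trajectory approaches a periodic one. -/
theorem exists_periodic_trajectory_tendsto (hA : A ∈ rowStochastic ℝ V) (hpos : ∀ i, 0 < A i i)
    {T : ℕ} (hT : T ≠ 0) (hu : Function.Periodic u T) (hsum : ∑ s ∈ Finset.range T, u s = 0)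
    (x : V → ℝ) : ∃ y, Function.Periodic (trajectory A c α u y) T ∧
      ∀ i, Tendsto (fun t => trajectory A c α u x t i - trajectory A c α u y t i) atTop (𝓝 0) := by
  obtain ⟨d, hd⟩ := exists_trajectory_eq_self (c := c) (α := α) hA hpos hT hsum
  obtain ⟨z, hz, hlim⟩ := exists_tendsto_pow_mulVec hA hpos (x - d)
  have hzt : ∀ t : ℕ, (A ^ t) *ᵥ z = z := by
    intro t
    induction t with
    | zero => simp
    | succ t ih => rw [pow_succ, ← mulVec_mulVec, hz, ih]
  refine ⟨d + z, trajectory_periodic hu ?_, ?_⟩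
  · have := trajectory_sub_trajectory (A := A) (c := c) (α := α) (u := u) (d + z) d T
    rw [add_sub_cancel_left, hzt, hd, sub_eq_iff_eq_add] at this
    rw [this, add_comm]
  · intro i
    have h : ∀ t, trajectory A c α u x t i - trajectory A c α u (d + z) t i =
        ((A ^ t) *ᵥ (x - d) - z) i := fun t => by
      rw [← Pi.sub_apply, trajectory_sub_trajectory, ← sub_sub, mulVec_sub _ (x - d), hzt]
    simp only [h]
    have := tendsto_pi_nhds.1 (hlim.sub_const z) i
    simpa using this

end Trajectories

/-! ### Vectors constant on clusters -/

section CommonInfluence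

variable {V κ : Type*} [Fintype V] [Fintype κ] [DecidableEq κ] {c : V → κ} {A : Matrix V V ℝ}
  {B : Matrix κ κ ℝ}

theorem HasCommonInfluence.mulVec_comp (h : HasCommonInfluence c A B) (f : κ → ℝ) :
    A *ᵥ (f ∘ c) = (B *ᵥ f) ∘ c := by
  ext i
  simp only [mulVec, dotProduct, Function.comp_apply, ← h i, Finset.sum_mul]
  rw [← Finset.sum_fiberwise Finset.univ c]
  exact Finset.sum_congr rfl fun q _ => Finset.sum_congr rfl fun j hj => by
    rw [(Finset.mem_filter.1 hj).2]

end CommonInfluence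

/-! ### Synchronization inside clusters -/

section Synchronization

variable {V κ : Type*} [Fintype V] [DecidableEq V] {c : V → κ}

/-- A solution of fixed point equations `v = M v + g ∘ c` with matrices `M` that preserve the
vectors constant on clusters is constant on clusters, if any two vertices of a cluster have a common
influence in one of the `M`. -/
theorem eq_of_common_influence {v : V → ℝ}
    (H : ∀ i i', c i = c i' → ∃ (M : Matrix V V ℝ) (g : κ → ℝ) (r : V),
      M ∈ rowStochastic ℝ V ∧ v = M *ᵥ v + g ∘ c ∧
      (∀ f : κ → ℝ, (M *ᵥ (f ∘ c)) i = (M *ᵥ (f ∘ c)) i') ∧ 0 < M i r ∧ 0 < M i' r)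
    {i i' : V} (hi : c i = c i') : v i = v i' := by
  have : Nonempty {p : V × V // c p.1 = c p.2} := ⟨⟨(i, i'), hi⟩⟩
  obtain ⟨⟨⟨a, b⟩, hab⟩, hmax⟩ :=
    Finite.exists_max fun p : {p : V × V // c p.1 = c p.2} => v p.1.1 - v p.1.2
  simp only at hab hmax
  have hle : ∀ j k, c j = c k → v j - v k ≤ v a - v b := fun j k hjk => hmax ⟨(j, k), hjk⟩
  suffices hab0 : v a - v b ≤ 0 by
    linarith [hle i i' hi, hle i' i hi.symm]
  by_contra! hpos
  set m := v a - v b with hm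
  obtain ⟨M, g, r, hM, hv, hf, hra, hrb⟩ := H a b hab
  -- Subtracting cluster minima puts all values in `[0, m]` without changing the difference of the
  -- two averages. These differ by `m`, so they are `m` at `a` and `0` at `b`; the common influence
  -- `r` would then have both values.
  let lo : κ → ℝ := fun q => ⨅ j : {j // c j = q}, v j
  have hlo : ∀ j, 0 ≤ (v - lo ∘ c) j := fun j =>
    sub_nonneg.2 (ciInf_le (Set.finite_range _).bddBelow (⟨j, rfl⟩ : {k // c k = c j}))
  have hhi : ∀ j, (v - lo ∘ c) j ≤ m := fun j => by
    have : Nonempty {k // c k = c j} := ⟨⟨j, rfl⟩⟩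
    have : v j - m ≤ lo (c j) := le_ciInf fun k => by linarith [hle j k k.2.symm]
    simp only [Pi.sub_apply, Function.comp_apply]
    linarith
  have hsplit : m = (M *ᵥ (v - lo ∘ c)) a - (M *ᵥ (v - lo ∘ c)) b := by
    have h1 := congrFun hv a
    have h2 := congrFun hv b
    simp only [Pi.add_apply, Function.comp_apply] at h1 h2
    simp only [mulVec_sub, Pi.sub_apply, hf lo]
    rw [hab] at h1
    linarith
  have ha := mulVec_le_of_mem_rowStochastic hM hhi a
  have hb := mulVec_nonneg_of_mem_rowStochastic hM hlo b
  have hb' : M b r * (v - lo ∘ c) r ≤ (M *ᵥ (v - lo ∘ c)) b :=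
    Finset.single_le_sum (f := fun j => M b j * (v - lo ∘ c) j)
      (fun j _ => mul_nonneg (hM.1 b j) (hlo j)) (Finset.mem_univ r)
  have ha' : M a r * (m - (v - lo ∘ c) r) ≤ m - (M *ᵥ (v - lo ∘ c)) a := by
    have h := Finset.single_le_sum (f := fun j => M a j * ((fun _ => m) - (v - lo ∘ c) : V → ℝ) j)
      (fun j _ => mul_nonneg (hM.1 a j) (sub_nonneg.2 (hhi j))) (Finset.mem_univ r)
    refine h.trans_eq ?_
    change (M *ᵥ ((fun _ => m) - (v - lo ∘ c))) a = _
    rw [mulVec_sub, mulVec_const_of_mem_rowStochastic hM]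
    rfl
  have h0 : (v - lo ∘ c) r ≤ 0 := by
    have : M b r * (v - lo ∘ c) r ≤ 0 := by linarith
    exact nonpos_of_mul_nonpos_right this hrb
  have h1 : m - (v - lo ∘ c) r ≤ 0 := by
    have : M a r * (m - (v - lo ∘ c) r) ≤ 0 := by linarith
    exact nonpos_of_mul_nonpos_right this hra
  linarith

variable {A : Matrix V V ℝ} {α : κ → ℝ} {u : ℕ → ℝ}

theorem pow_pos_mono (hA : A ∈ rowStochastic ℝ V) (hpos : ∀ i, 0 < A i i) {i j : V} {k l : ℕ}
    (hkl : k ≤ l) (h : 0 < (A ^ k) i j) : 0 < (A ^ l) i j := by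
  induction hkl with
  | refl => exact h
  | step _ ih =>
    rw [pow_succ', mul_apply]
    exact (mul_pos (hpos i) ih).trans_le (Finset.single_le_sum
      (f := fun k => A i k * (A ^ _) k j)
      (fun k _ => mul_nonneg (hA.1 i k) ((pow_mem hA _).1 k j)) (Finset.mem_univ i))

theorem exists_pow_pos_of_reflTransGen (hA : A ∈ rowStochastic ℝ V) {r i : V}
    (h : Relation.ReflTransGen (matrixDigraph A).Adj r i) : ∃ k : ℕ, 0 < (A ^ k) i r := by
  induction h with
  | refl => exact ⟨0, by simp⟩
  | @tail j i _ hji ih =>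
    obtain ⟨k, hk⟩ := ih
    refine ⟨k + 1, ?_⟩
    rw [pow_succ', mul_apply]
    exact (mul_pos (a := A i j) hji hk).trans_le (Finset.single_le_sum
      (f := fun l => A i l * (A ^ k) l r)
      (fun l _ => mul_nonneg (hA.1 i l) ((pow_mem hA _).1 l r)) (Finset.mem_univ j))

variable [Fintype κ] [DecidableEq κ] {B : Matrix κ κ ℝ}

theorem HasCommonInfluence.pow_mulVec_comp (h : HasCommonInfluence c A B) (f : κ → ℝ) (k : ℕ) :
    (A ^ k) *ᵥ (f ∘ c) = ((B ^ k) *ᵥ f) ∘ c := by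
  induction k with
  | zero => simp
  | succ k ih => rw [pow_succ', pow_succ', ← mulVec_mulVec, ih, h.mulVec_comp, mulVec_mulVec]

theorem HasCommonInfluence.exists_trajectory_eq (h : HasCommonInfluence c A B) (x : V → ℝ) (t : ℕ) :
    ∃ g : κ → ℝ, trajectory A c α u x t = (A ^ t) *ᵥ x + g ∘ c := by
  induction t with
  | zero => exact ⟨0, by ext; simp [trajectory]⟩
  | succ t ih =>
    obtain ⟨g, hg⟩ := ih
    refine ⟨B *ᵥ g + u t • α, ?_⟩
    rw [trajectory_succ, hg, mulVec_add, mulVec_mulVec, ← pow_succ', h.mulVec_comp, add_assoc]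
    rfl

/-- Under cluster-spanning-trees, the states in a periodic trajectory are constant on clusters. -/
theorem eq_of_trajectory_periodic (hA : A ∈ rowStochastic ℝ V) (hpos : ∀ i, 0 < A i i)
    (h : HasCommonInfluence c A B) (htree : HasClusterSpanningTrees (matrixDigraph A) c)
    {T : ℕ} (hT : 0 < T) {x : V → ℝ} (hx : Function.Periodic (trajectory A c α u x) T)
    (t : ℕ) {i i' : V} (hi : c i = c i') :
    trajectory A c α u x t i = trajectory A c α u x t i' := by
  refine eq_of_common_influence (fun i i' hi => ?_) hi
  obtain ⟨r, hr⟩ := htree (c i)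
  obtain ⟨k, hk⟩ := exists_pow_pos_of_reflTransGen hA (hr i rfl)
  obtain ⟨k', hk'⟩ := exists_pow_pos_of_reflTransGen hA (hr i' hi.symm)
  obtain ⟨g, hg⟩ := h.exists_trajectory_eq (α := α) (u := fun s => u (s + t))
    (trajectory A c α u x t) ((k + k') * T)
  -- The exponent is a multiple of the period and at least both `k` and `k'`; self-links keep the
  -- entries positive up to it.
  refine ⟨A ^ ((k + k') * T), g, r, pow_mem hA _, ?_, ?_, ?_, ?_⟩
  · rw [← hg, ← trajectory_add, add_comm]
    exact ((hx.nat_mul (k + k')) t).symm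
  · intro f
    simp [h.pow_mulVec_comp, hi]
  · exact pow_pos_mono hA hpos ((Nat.le_add_right k k').trans (Nat.le_mul_of_pos_right _ hT)) hk
  · exact pow_pos_mono hA hpos ((Nat.le_add_left k' k).trans (Nat.le_mul_of_pos_right _ hT)) hk'

end Synchronization

/-! ### Fourier coefficients of the reduced system -/

section Fourier

variable {κ : Type*} [Fintype κ] [DecidableEq κ]

/-- The Fourier coefficient at the frequency `ζ` of a periodic solution of a linear system with
periodic input. -/
theorem one_sub_smul_mulVec_fourier {T : ℕ} {ζ : ℂ} (hζ : ζ ^ T = 1) {B : Matrix κ κ ℝ} {α : κ → ℝ}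
    {u : ℕ → ℝ} {v : ℕ → κ → ℝ} (hv : Function.Periodic v T)
    (hsys : ∀ t, v (t + 1) = B *ᵥ v t + u t • α) :
    (1 - ζ • B.map Complex.ofReal) *ᵥ (fun p => ∑ t ∈ Finset.range T, ζ ^ t * (v t p : ℂ)) =
      (ζ * ∑ t ∈ Finset.range T, ζ ^ t * (u t : ℂ)) • fun p => (α p : ℂ) := by
  ext p
  have hshift : ∑ t ∈ Finset.range T, ζ ^ (t + 1) * (v (t + 1) p : ℂ) =
      ∑ t ∈ Finset.range T, ζ ^ t * (v t p : ℂ) := by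
    have h := Finset.sum_range_succ' (fun t => ζ ^ t * (v t p : ℂ)) T
    have hT : v T = v 0 := by simpa using hv 0
    rw [Finset.sum_range_succ, hζ, hT] at h
    simpa using h.symm
  rw [sub_mulVec, one_mulVec, smul_mulVec, Pi.sub_apply, Pi.smul_apply, ← hshift]
  have hstep : ∀ t, (v (t + 1) p : ℂ) = (∑ q, (B p q : ℂ) * v t q) + u t * α p := fun t => by
    rw [hsys t]
    simp [mulVec, dotProduct]
  simp only [hstep, mulVec, dotProduct, map_apply, Pi.smul_apply, smul_eq_mul, Finset.mul_sum,
    mul_add, Finset.sum_add_distrib, Finset.sum_mul]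
  rw [Finset.sum_comm (s := Finset.univ), sub_eq_iff_eq_add, add_comm]
  congr 1
  · exact Finset.sum_congr rfl fun t _ => by ring
  · exact Finset.sum_congr rfl fun t _ => Finset.sum_congr rfl fun q _ => by ring

theorem one_sub_lt_norm_one_sub_mul {ζ : ℂ} (hζ : ‖ζ‖ = 1) (hne : ζ ≠ 1) {β : ℝ} (hβ : 0 < β) :
    1 - β < ‖1 - ζ * β‖ := by
  have hsq : ζ.re * ζ.re + ζ.im * ζ.im = 1 := by
    rw [← Complex.normSq_apply, Complex.normSq_eq_norm_sq, hζ, one_pow]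
  have hre : ζ.re < 1 := by
    refine lt_of_le_of_ne (hζ ▸ Complex.re_le_norm ζ) fun h => hne ?_
    rw [h] at hsq
    exact Complex.ext h (by simpa using hsq)
  refine lt_of_pow_lt_pow_left₀ 2 (norm_nonneg _) ?_
  rw [← Complex.normSq_eq_norm_sq, Complex.normSq_apply]
  simp only [Complex.sub_re, Complex.one_re, Complex.mul_re, Complex.ofReal_re, Complex.ofReal_im,
    Complex.sub_im, Complex.one_im, Complex.mul_im]
  -- The difference of the squares is `2 * β * (1 - ζ.re)`.
  nlinarith [mul_pos hβ (sub_pos.2 hre), congrArg (fun s => β ^ 2 * s) hsq]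

theorem det_one_sub_smul_ne_zero {B : Matrix κ κ ℝ} (hB : B ∈ rowStochastic ℝ κ)
    (hpos : ∀ p, 0 < B p p) {ζ : ℂ} (hζ : ‖ζ‖ = 1) (hne : ζ ≠ 1) :
    (1 - ζ • B.map Complex.ofReal).det ≠ 0 := by
  refine det_ne_zero_of_sum_row_lt_diag fun p => ?_
  have hoff : ∀ q ∈ Finset.univ.erase p, ‖(1 - ζ • B.map Complex.ofReal) p q‖ = B p q := by
    intro q hq
    simp [one_apply_ne (Finset.ne_of_mem_erase hq).symm, hζ, abs_of_nonneg (hB.1 p q)]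
  have hrow := sum_row_of_mem_rowStochastic hB p
  rw [← Finset.add_sum_erase _ _ (Finset.mem_univ p)] at hrow
  rw [Finset.sum_congr rfl hoff]
  have h := one_sub_lt_norm_one_sub_mul hζ hne (hpos p)
  simp only [Matrix.sub_apply, one_apply_eq, Matrix.smul_apply, map_apply, smul_eq_mul]
  linarith

/-- Cramer's rule. The adjugate replaces the inverse because it is continuous in the matrix
everywhere, which serves measurability below. -/
theorem adjugate_mulVec_ne_of_fourier {N : Matrix κ κ ℂ} {V a : κ → ℂ} {s : ℂ}
    (h : N *ᵥ V = s • a) (hs : s ≠ 0) {p q : κ}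
    (hpq : (N.adjugate *ᵥ a) p ≠ (N.adjugate *ᵥ a) q) : V p ≠ V q := by
  intro hV
  have h1 : N.det • V = s • (N.adjugate *ᵥ a) := by
    rw [← mulVec_smul, ← h, mulVec_mulVec, adjugate_mul, smul_mulVec, one_mulVec]
  have hp := congrFun h1 p
  have hq := congrFun h1 q
  simp only [Pi.smul_apply, smul_eq_mul] at hp hq
  rw [hV, hq] at hp
  exact hpq (mul_left_cancel₀ hs hp).symm

end Fourier

/-! ### Genericity of the parameters -/

section AlmostEverywhere

/-- A nonzero linear map on `ℝⁿ` is nonzero almost everywhere. -/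
theorem ae_linearMap_ne_zero {ι F : Type*} [Fintype ι] [AddCommGroup F] [Module ℝ F]
    (f : (ι → ℝ) →ₗ[ℝ] F) (hf : f ≠ 0) : ∀ᵐ x : ι → ℝ, f x ≠ 0 := by
  have h := Measure.addHaar_submodule (volume : Measure (ι → ℝ)) f.ker
    (fun h => hf (LinearMap.ker_eq_top.1 h))
  rw [ae_iff]
  simp only [not_not]
  exact h

variable {κ : Type*} [Fintype κ] [DecidableEq κ]

theorem ae_adjugate_mulVec_ne {N : Matrix κ κ ℂ} (hN : N.det ≠ 0) {p q : κ} (hpq : p ≠ q) :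
    ∀ᵐ α : κ → ℝ, (N.adjugate *ᵥ fun k => (α k : ℂ)) p ≠ (N.adjugate *ᵥ fun k => (α k : ℂ)) q := by
  let f : (κ → ℝ) →ₗ[ℝ] ℂ :=
    { toFun := fun α => (N.adjugate *ᵥ fun k => (α k : ℂ)) p - (N.adjugate *ᵥ fun k => (α k : ℂ)) q
      map_add' := fun α β => by
        simp only [mulVec, dotProduct, Pi.add_apply, Complex.ofReal_add, mul_add,
          Finset.sum_add_distrib]
        ring
      map_smul' := fun s α => by
        simp only [mulVec, dotProduct, Pi.smul_apply, smul_eq_mul, Complex.ofReal_mul,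
          RingHom.id_apply, Complex.real_smul, mul_sub, Finset.mul_sum]
        congr 1 <;> exact Finset.sum_congr rfl fun k _ => by ring }
  have hf : f ≠ 0 := by
    intro h0
    -- Otherwise rows `p` and `q` of the adjugate agree, and comparing the entries `(p, p)` and `(q,
    -- p)` of `N.adjugate * N` gives `N.det = 0`.
    have hrow : ∀ k, N.adjugate p k = N.adjugate q k := fun k => by
      have h := LinearMap.congr_fun h0 (Pi.single k 1)
      have hs : (fun j => ((Pi.single k (1 : ℝ) : κ → ℝ) j : ℂ)) = Pi.single k 1 := by
        ext j
        by_cases hj : j = k <;> simp [hj]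
      change (N.adjugate *ᵥ fun j => ((Pi.single k (1 : ℝ) : κ → ℝ) j : ℂ)) p -
        (N.adjugate *ᵥ fun j => ((Pi.single k (1 : ℝ) : κ → ℝ) j : ℂ)) q = 0 at h
      rw [hs, mulVec_single_one, sub_eq_zero] at h
      exact h
    have h1 := congrFun (congrFun (adjugate_mul N) p) p
    have h2 := congrFun (congrFun (adjugate_mul N) q) p
    rw [mul_apply] at h1 h2
    simp only [hrow] at h1
    rw [h1] at h2
    simp [one_apply_ne hpq.symm] at h2
    exact hN h2
  filter_upwards [ae_linearMap_ne_zero f hf] with α hα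
  exact fun h => hα (sub_eq_zero.2 h)

theorem ae_prod_adjugate_mulVec_ne {ι ι' : Type*} [Fintype ι] [Fintype ι']
    {N : (ι → ℝ) → Matrix κ κ ℂ} (hN : Continuous N) :
    ∀ᵐ τ : (ι → ℝ) × (κ → ℝ) × (ι' → ℝ), (N τ.1).det ≠ 0 → ∀ p q, p ≠ q →
      ((N τ.1).adjugate *ᵥ fun k => (τ.2.1 k : ℂ)) p ≠
        ((N τ.1).adjugate *ᵥ fun k => (τ.2.1 k : ℂ)) q := by
  suffices h : ∀ p q, p ≠ q → ∀ᵐ τ : (ι → ℝ) × (κ → ℝ) × (ι' → ℝ), (N τ.1).det ≠ 0 →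
      ((N τ.1).adjugate *ᵥ fun k => (τ.2.1 k : ℂ)) p ≠
        ((N τ.1).adjugate *ᵥ fun k => (τ.2.1 k : ℂ)) q by
    have h' := ae_all_iff.2 fun p => ae_all_iff.2 fun q => (ae_all_iff.2 (h p q))
    filter_upwards [h'] with τ hτ hdet p q hpq using hτ p q hpq hdet
  intro p q hpq
  have hcont : ∀ r, Continuous fun τ : (ι → ℝ) × (κ → ℝ) × (ι' → ℝ) =>
      ((N τ.1).adjugate *ᵥ fun k => (τ.2.1 k : ℂ)) r := fun r =>
    (continuous_apply r).comp ((hN.comp continuous_fst).matrix_adjugate.matrix_mulVec (by fun_prop))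
  have hmeas : MeasurableSet {τ : (ι → ℝ) × (κ → ℝ) × (ι' → ℝ) | (N τ.1).det ≠ 0 →
      ((N τ.1).adjugate *ᵥ fun k => (τ.2.1 k : ℂ)) p ≠
        ((N τ.1).adjugate *ᵥ fun k => (τ.2.1 k : ℂ)) q} := by
    refine MeasurableSet.imp ?_ ?_
    · exact (isOpen_ne_fun (hN.comp continuous_fst).matrix_det continuous_const).measurableSet
    · exact (isOpen_ne_fun (hcont p) (hcont q)).measurableSet
  refine (Measure.ae_prod_iff_ae_ae hmeas).2 (Eventually.of_forall fun b => ?_)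
  by_cases hb : (N b).det = 0
  · simp [hb]
  · filter_upwards [Measure.quasiMeasurePreserving_fst.ae (ae_adjugate_mulVec_ne hb hpq)]
      with x hx _ using hx

theorem ae_fourier_periodicInput_ne_zero {T : ℕ} (hT : 2 ≤ T) {ζ : ℂ} (hne : ζ ≠ 1) :
    ∀ᵐ w : Finset.Ioo 0 T → ℝ,
      ∑ t ∈ Finset.range T, ζ ^ t * (periodicInput T w t : ℂ) ≠ 0 := by
  let f : (Finset.Ioo 0 T → ℝ) →ₗ[ℝ] ℂ :=
    { toFun := fun w => ∑ t ∈ Finset.range T, ζ ^ t * (periodicInput T w t : ℂ)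
      map_add' := fun w z => by
        rw [← Finset.sum_add_distrib]
        refine Finset.sum_congr rfl fun t _ => ?_
        by_cases h : t % T ∈ Finset.Ioo 0 T
        · simp only [periodicInput, h, dif_pos, Pi.add_apply, Complex.ofReal_add, mul_add]
        · simp only [periodicInput, h, dif_neg, Pi.add_apply, Finset.sum_add_distrib,
            not_false_eq_true, Complex.ofReal_add, Complex.ofReal_neg]
          ring
      map_smul' := fun s w => by
        rw [RingHom.id_apply, Complex.real_smul, Finset.mul_sum]
        refine Finset.sum_congr rfl fun t _ => ?_
        by_cases h : t % T ∈ Finset.Ioo 0 T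
        · simp only [periodicInput, h, dif_pos, Pi.smul_apply, smul_eq_mul, Complex.ofReal_mul]
          ring
        · simp only [periodicInput, h, dif_neg, Pi.smul_apply, smul_eq_mul, ← Finset.mul_sum,
            not_false_eq_true, Complex.ofReal_mul, Complex.ofReal_neg]
          ring }
  refine ae_linearMap_ne_zero f fun h0 => ?_
  have h1 : 1 ∈ Finset.Ioo 0 T := by simp; omega
  -- The input with `u 1 = 1` and all other free values `0` has `u 0 = -1`, so its coefficient is `ζ
  -- - 1`.
  have h := LinearMap.congr_fun h0 (Pi.single ⟨1, h1⟩ 1)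
  change ∑ t ∈ Finset.range T, ζ ^ t * (periodicInput T (Pi.single ⟨1, h1⟩ 1) t : ℂ) = 0 at h
  obtain ⟨S, rfl⟩ : ∃ S, T = S + 1 + 1 := ⟨T - 2, by omega⟩
  rw [Finset.sum_range_succ', Finset.sum_range_succ', Finset.sum_eq_zero, zero_add] at h
  · have e1 : periodicInput (S + 1 + 1) (Pi.single ⟨1, h1⟩ 1) (0 + 1) = 1 := by
      simp [periodicInput]
    have e0 : periodicInput (S + 1 + 1) (Pi.single ⟨1, h1⟩ 1) 0 = -1 := by
      simp [periodicInput]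
    rw [e1, e0] at h
    refine hne ?_
    push_cast at h
    linear_combination h
  · intro t ht
    have ht' : t + 1 + 1 < S + 1 + 1 := by have := Finset.mem_range.1 ht; omega
    have hm : (t + 1 + 1) % (S + 1 + 1) = t + 1 + 1 := Nat.mod_eq_of_lt ht'
    have hI : t + 1 + 1 ∈ Finset.Ioo 0 (S + 1 + 1) := by simp; omega
    have : periodicInput (S + 1 + 1) (Pi.single ⟨1, h1⟩ 1) (t + 1 + 1) = 0 := by
      simp only [periodicInput, hm, hI, dif_pos]
      exact Pi.single_eq_of_ne (by simp) _
    simp [this]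

end AlmostEverywhere

/-! ### Transfer from periodic limits to trajectories -/

section Limits

variable {V κ : Type*}

theorem isBoundedTrajectory_of_tendsto_periodic [Finite V] {x y : ℕ → V → ℝ} {T : ℕ} (hT : 0 < T)
    (hy : Function.Periodic y T) (h : ∀ i, Tendsto (fun t => x t i - y t i) atTop (𝓝 0)) :
    IsBoundedTrajectory x := by
  have hi : ∀ i, ∃ M, ∀ t, |x t i| ≤ M := fun i => by
    obtain ⟨R, hR⟩ := (Metric.isBounded_range_of_tendsto _ (h i)).exists_norm_le
    refine ⟨R + ∑ s ∈ Finset.range T, |y s i|, fun t => ?_⟩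
    have h1 : |x t i - y t i| ≤ R := hR _ ⟨t, rfl⟩
    have h2 : |y t i| ≤ ∑ s ∈ Finset.range T, |y s i| := by
      rw [← hy.map_mod_nat t]
      exact Finset.single_le_sum (f := fun s => |y s i|) (fun s _ => abs_nonneg _)
        (Finset.mem_range.2 (Nat.mod_lt t hT))
    calc |x t i| = |(x t i - y t i) + y t i| := by rw [sub_add_cancel]
      _ ≤ _ := (abs_add_le _ _).trans (add_le_add h1 h2)
  choose M hM using hi
  obtain ⟨K, hK⟩ := (Set.finite_range M).bddAbove
  exact ⟨K, fun t i => (hM i t).trans (hK ⟨i, rfl⟩)⟩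

theorem limsup_abs_sub_pos_of_tendsto_periodic {x y : ℕ → V → ℝ} {T : ℕ} (hT : 0 < T)
    (hy : Function.Periodic y T) (h : ∀ i, Tendsto (fun t => x t i - y t i) atTop (𝓝 0))
    {i j : V} {s : ℕ} (hs : y s i ≠ y s j) :
    0 < limsup (fun t => ((|x t i - x t j| : ℝ) : EReal)) atTop := by
  have hε : 0 < |y s i - y s j| := abs_pos.2 (sub_ne_zero.2 hs)
  set ε := |y s i - y s j|
  have hlim : Tendsto (fun k : ℕ => s + k * T) atTop atTop :=
    tendsto_atTop_mono (fun k => (Nat.le_mul_of_pos_right k hT).trans (Nat.le_add_left _ s)) tendsto_id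
  have hsub : Tendsto (fun k : ℕ => |x (s + k * T) i - x (s + k * T) j|) atTop (𝓝 ε) := by
    have h1 := ((((h i).sub (h j)).comp hlim).add_const (y s i - y s j)).abs
    rw [sub_zero, zero_add] at h1
    refine h1.congr fun k => ?_
    have hk : y (s + k * T) = y s := hy.nat_mul k s
    simp only [Function.comp_apply, hk]
    congr 1
    ring
  have hfreq : ∃ᶠ t in atTop, ((ε / 2 : ℝ) : EReal) ≤ ((|x t i - x t j| : ℝ) : EReal) := by
    refine hlim.frequently (Eventually.frequently ?_)
    filter_upwards [hsub.eventually_const_lt (half_lt_self hε)] with k hk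
    exact EReal.coe_le_coe_iff.2 hk.le
  exact lt_of_lt_of_le (EReal.coe_pos.2 (half_pos hε)) (le_limsup_of_frequently_le hfreq)

end Limits

open Classical in
theorem continuous_matrixOfFree {V κ : Type*} [Fintype κ] (G : Digraph V) (c : V → κ) :
    Continuous (matrixOfFree G c) := by
  refine continuous_pi fun p => continuous_pi fun q => ?_
  have hoff : ∀ q', Continuous fun b : FreeEntry G c → ℝ =>
      if h : p ≠ q' ∧ ClusterLink G c q' p then b ⟨(p, q'), h⟩ else 0 := fun q' => by
    by_cases h : p ≠ q' ∧ ClusterLink G c q' p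
    · simp only [dif_pos h]; exact continuous_apply _
    · simp only [dif_neg h]; exact continuous_const
  unfold matrixOfFree
  by_cases hpq : p = q
  · simp only [if_pos hpq]
    exact continuous_const.sub (continuous_finsetSum _ fun q' _ => hoff q')
  · simp only [if_neg hpq]
    exact hoff q

/-! ### Reduction of a coupling to the clusters -/

section Couplings

variable {V κ : Type*} [Fintype V] [DecidableEq V] [DecidableEq κ] {G : Digraph V} {c : V → κ}
  {A : Matrix V V ℝ} {B : Matrix κ κ ℝ}

theorem IsCoupling.diag_pos (h : IsCoupling G c A B) (hself : SelfLinked G) (i : V) : 0 < A i i := by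
  obtain ⟨-, rfl, -⟩ := h
  exact hself i

theorem IsCoupling.reduced_diag_pos (h : IsCoupling G c A B) (hc : Function.Surjective c)
    (hself : SelfLinked G) (p : κ) : 0 < B p p := by
  obtain ⟨i, rfl⟩ := hc p
  rw [← h.2.2 i (c i)]
  exact (h.diag_pos hself i).trans_le (Finset.single_le_sum (f := fun j => A i j)
    (fun j _ => h.1.1 i j) (by simp))

variable [Fintype κ]

theorem IsCoupling.reduced_mem_rowStochastic (h : IsCoupling G c A B) (hc : Function.Surjective c) :
    B ∈ rowStochastic ℝ κ := by
  rw [mem_rowStochastic_iff_sum]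
  refine ⟨fun p q => ?_, fun p => ?_⟩ <;> obtain ⟨i, rfl⟩ := hc p
  · rw [← h.2.2 i q]
    exact Finset.sum_nonneg fun j _ => h.1.1 i j
  · simp_rw [← h.2.2 i]
    rw [Finset.sum_fiberwise, sum_row_of_mem_rowStochastic h.1]

/-- Every trajectory of a coupling approaches a periodic trajectory of the reduced system. -/
theorem IsCoupling.exists_periodic_reduced_tendsto (h : IsCoupling G c A B)
    (hc : Function.Surjective c) (hself : SelfLinked G) (htree : HasClusterSpanningTrees G c)
    {T : ℕ} (hT : 0 < T) (α : κ → ℝ) {u : ℕ → ℝ} (hu : Function.Periodic u T)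
    (hsum : ∑ s ∈ Finset.range T, u s = 0) (x : V → ℝ) :
    ∃ v : ℕ → κ → ℝ, Function.Periodic v T ∧ (∀ t, v (t + 1) = B *ᵥ v t + u t • α) ∧
      ∀ i, Tendsto (fun t => trajectory A c α u x t i - v t (c i)) atTop (𝓝 0) := by
  have hpos := h.diag_pos hself
  obtain ⟨y, hy, hlim⟩ :=
    exists_periodic_trajectory_tendsto (c := c) (α := α) h.1 hpos hT.ne' hu hsum x
  have htree' : HasClusterSpanningTrees (matrixDigraph A) c := h.2.1 ▸ htree
  set v : ℕ → κ → ℝ := fun t p => trajectory A c α u y t (Function.surjInv hc p)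
  have hv : ∀ t, trajectory A c α u y t = v t ∘ c := fun t => funext fun i =>
    eq_of_trajectory_periodic h.1 hpos h.2.2 htree' hT hy t (Function.surjInv_eq hc (c i)).symm
  refine ⟨v, fun t => ?_, fun t => ?_, fun i => ?_⟩
  · simp only [v, hy t]
  · refine hc.injective_comp_right ?_
    change v (t + 1) ∘ c = _
    rw [← hv, trajectory_succ, hv, h.2.2.mulVec_comp]
    rfl
  · simpa only [hv, Function.comp_apply] using hlim i

end Couplings

end ClusterConsensus

/-! ### The main theorem -/

open ClusterConsensus in
theorem theorem2 {V κ : Type*} [Fintype V] [DecidableEq V] [Fintype κ] [DecidableEq κ]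
    (G : Digraph V) (c : V → κ) (hc : Function.Surjective c)
    (hself : ClusterConsensus.SelfLinked G)
    (hlink : ClusterConsensus.NoneOrEveryLink G c)
    (htree : ClusterConsensus.HasClusterSpanningTrees G c)
    (T : ℕ) (hT : 2 ≤ T) :
    -- cluster consensus for almost every parameter triple and almost every initial value
    ClusterConsensus.ForAlmostEveryParameter G c T (fun B α w =>
      ∀ A : Matrix V V ℝ, ClusterConsensus.IsCoupling G c A B →
        ∀ᵐ x₀ : V → ℝ, ClusterConsensus.IsClusterConsensus c
          (ClusterConsensus.trajectory A c α (ClusterConsensus.periodicInput T w) x₀)) ∧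
    -- each cluster converges to a `T`-periodic trajectory
    (∀ B α w, (B, α, w) ∈ ClusterConsensus.parameterSet G c T →
      ∀ A : Matrix V V ℝ, ClusterConsensus.IsCoupling G c A B →
        ∀ x₀ : V → ℝ, ∃ v : κ → ℕ → ℝ, (∀ p, Function.Periodic (v p) T) ∧
          ∀ j, Filter.Tendsto (fun t => |ClusterConsensus.trajectory A c α
            (ClusterConsensus.periodicInput T w) x₀ t j - v (c j) t|)
            Filter.atTop (nhds 0)) := by
  have hT0 : 0 < T := by omega
  constructor
  · have hprim := Complex.isPrimitiveRoot_exp T hT0.ne'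
    set ζ := Complex.exp (2 * Real.pi * Complex.I / T)
    have hζ1 : ζ ≠ 1 := hprim.ne_one (by omega)
    have hζn : ‖ζ‖ = 1 := hprim.norm'_eq_one hT0.ne'
    have hN : Continuous fun b => 1 - ζ • (matrixOfFree G c b).map Complex.ofReal :=
      continuous_const.sub (((continuous_matrixOfFree G c).matrix_map Complex.continuous_ofReal).const_smul ζ)
    have hU := Measure.quasiMeasurePreserving_snd (μ := (volume : Measure (FreeEntry G c → ℝ))) |>.ae
      (Measure.quasiMeasurePreserving_snd (μ := (volume : Measure (κ → ℝ))) |>.ae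
        (ae_fourier_periodicInput_ne_zero hT hζ1))
    filter_upwards [ae_prod_adjugate_mulVec_ne hN, hU] with τ hτ hτU _ A hA
    refine Eventually.of_forall fun x₀ => ?_
    obtain ⟨v, hv, hsys, hlim⟩ := hA.exists_periodic_reduced_tendsto hc hself htree hT0 τ.2.1
      (periodicInput_periodic T τ.2.2) (sum_periodicInput hT0 τ.2.2) x₀
    have hvc : Function.Periodic (fun t => v t ∘ c) T := fun t => by simp only [hv t]
    refine ⟨isBoundedTrajectory_of_tendsto_periodic hT0 hvc hlim, fun i j hij => ?_,
      fun i j hij => ?_⟩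
    · have := ((hlim i).sub (hlim j)).abs
      simpa [hij] using this
    · have hdet := det_one_sub_smul_ne_zero (hA.reduced_mem_rowStochastic hc)
        (hA.reduced_diag_pos hc hself) hζn hζ1
      have hne := adjugate_mulVec_ne_of_fourier
        (one_sub_smul_mulVec_fourier hprim.pow_eq_one hv hsys)
        (mul_ne_zero (hprim.ne_zero hT0.ne') hτU) (hτ hdet _ _ hij)
      -- Distinct Fourier coefficients force the two periodic limits to differ at some time, hence
      -- once in every period.
      obtain ⟨s, hs⟩ : ∃ s, v s (c i) ≠ v s (c j) := by
        by_contra! hall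
        exact hne (by simp only [hall])
      exact limsup_abs_sub_pos_of_tendsto_periodic hT0 hvc hlim hs
  · intro B α w _ A hA x₀
    obtain ⟨v, hv, -, hlim⟩ := hA.exists_periodic_reduced_tendsto hc hself htree hT0 α
      (periodicInput_periodic T w) (sum_periodicInput hT0 w) x₀
    refine ⟨fun p t => v t p, fun p t => by simp only [hv t], fun j => ?_⟩
    simpa using (hlim j).abs
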